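/- Let $X$ be a $T_1$-space and let $\tau$ be an infinite cardinal. The following are equivalent. (a) $X$ is countably paracompact (every countable open cover of $X$ has a locally finite open refinement) and $\tau$-collectionwise normal, that is, $X$ is a $T_1$-space and for every discrete collection $\mathscr{D}$ of closed subsets of $X$ with $|\mathscr{D}|\le\tau$ there is a discrete family $\{U_D : D\in\mathscr{D}\}$ of open subsets of $X$, indexed by $\mathscr{D}$, such that $D\subset U_D$ for every $D\in\mathscr{D}$. (A family of subsets of $X$ is discrete if every point of $X$ has a neighbourhood that meets at most one member of the family.) (b) For every real Banach space $E$ whose topological weight $w(E)$ (the least cardinality of a base) is at most $\tau$, every map $\varphi$ that assigns to each $x\in X$ a convex set $\varphi(x)\subset E$ which is either nonempty and compact or equal to $E$, and which is lower semi-continuous in the sense that $\{x\in X:\varphi(x)\cap U\neq\emptyset\}$ is open in $X$ for every open $U\subset E$, every lower semi-continuous function $\eta:X\to(0,+\infty)$, and every continuous map $g:X\to E$ with $d(g(x),\varphi(x))<\eta(x)$ for all $x\in X$, there is a continuous map $f:X\to E$ such that $f(x)\in\varphi(x)$ and $d(f(x),g(x))<\eta(x)$ for all $x\in X$. Here $d$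 is the metric given by the norm of $E$, and $d(y,S)=\inf_{s\in S}d(y,s)$. -/

import Mathlib

open scoped Topology Cardinal

universe u

/-- An indexed family of subsets of `X` is discrete if every point of `X` has a neighbourhood that
meets at most one member of the family (members are counted by their index). -/
def IsDiscreteFamily {X : Type*} [TopologicalSpace X] {ι : Type*} (F : ι → Set X) : Prop :=
  ∀ x : X, ∃ N ∈ 𝓝 x, {i : ι | (F i ∩ N).Nonempty}.Subsingleton

/-- `X` is `τ`-collectionwise normal: it is a `T₁`-space, and every discrete collection of at most
`τ` closed sets can be expanded to a discrete family of open sets. -/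
structure IsCollectionwiseNormal (X : Type u) [TopologicalSpace X] (τ : Cardinal.{u}) : Prop where
  t1 : T1Space X
  exists_expansion : ∀ 𝒟 : Set (Set X), (∀ D ∈ 𝒟, IsClosed D) →
    IsDiscreteFamily (fun D : 𝒟 => (D : Set X)) → #𝒟 ≤ τ →
    ∃ U : 𝒟 → Set X, (∀ D, IsOpen (U D)) ∧ IsDiscreteFamily U ∧ ∀ D : 𝒟, (D : Set X) ⊆ U D

/-- `X` is countably paracompact: every countable open cover has a locally finite open
refinement. -/
def IsCountablyParacompact (X : Type*) [TopologicalSpace X] : Prop :=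
  ∀ 𝒰 : Set (Set X), 𝒰.Countable → (∀ U ∈ 𝒰, IsOpen U) → ⋃₀ 𝒰 = Set.univ →
    ∃ 𝒱 : Set (Set X), (∀ V ∈ 𝒱, IsOpen V) ∧ ⋃₀ 𝒱 = Set.univ ∧
      LocallyFinite (fun V : 𝒱 => (V : Set X)) ∧ ∀ V ∈ 𝒱, ∃ U ∈ 𝒰, V ⊆ U

/-- The weight of a topological space: the least cardinality of a base. -/
noncomputable def topologicalWeight (E : Type u) [TopologicalSpace E] : Cardinal.{u} :=
  sInf {κ | ∃ B : Set (Set E), TopologicalSpace.IsTopologicalBasis B ∧ #B = κ}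

/-- The nonempty compact (closed) subsets of `E`, together with `E` itself. -/
def compactsOrUniv (E : Type*) [TopologicalSpace E] : Set (Set E) :=
  {S | S.Nonempty ∧ IsClosed S ∧ IsCompact S} ∪ {Set.univ}

/-- `f` is a selection for the set-valued map `φ`. -/
def IsSelection {X E : Type*} (f : X → E) (φ : X → Set E) : Prop :=
  ∀ x, f x ∈ φ x

/-- `g` is an `η`-selection for the (nonempty-valued) map `φ`: the distance from `g x` to the set
`φ x` is less than `η x` for every `x`. -/
def IsApproxSelection {X E : Type*} [PseudoMetricSpace E] (g : X → E) (η : X → ℝ)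
    (φ : X → Set E) : Prop :=
  ∀ x, Metric.infDist (g x) (φ x) < η x

/-! Forward direction. Countable paracompactness and normality insert a continuous `α` strictly
between `d(g, φ)` and `η`; replacing `y` by `(y - g) / α` reduces the claim to finding a selection
in the closed unit ball when every value meets the open one. Michael's iteration builds it from
partitions of unity, with one obstacle: pulling a fine locally finite cover of `E` back along `φ`
gives a cover that is point-finite only where the value is compact. Where the value is all of `E`,
the current approximation already lies in it, and preimages under that approximation are locally
finite. On the remaining closed set the Michael–Nagami argument turns the point-finite cover into a
locally finite one.

Converse. Expansions come from a selection in `ℓ¹(𝒟)` of the map sending points of `D` to the unit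
vector `e D` and all other points to the whole space. Countable paracompactness comes from a real
function pinned below 1 by `η` and forced towards 1 as the first covering index grows. -/

namespace IsDiscreteFamily

variable {X ι : Type*} [TopologicalSpace X] {F : ι → Set X}

theorem eq_of_mem (hF : IsDiscreteFamily F) {x : X} {i j : ι} (hi : x ∈ F i) (hj : x ∈ F j) :
    i = j := by
  obtain ⟨N, hN, hs⟩ := hF x
  exact hs ⟨x, hi, mem_of_mem_nhds hN⟩ ⟨x, hj, mem_of_mem_nhds hN⟩

end IsDiscreteFamily

namespace IsCollectionwiseNormal

variable {X : Type u} [TopologicalSpace X] {τ : Cardinal.{u}}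

/-- The expansion property for indexed families, in which the empty set may be repeated. -/
theorem exists_indexed_expansion (hX : IsCollectionwiseNormal X τ) {ι : Type u} (hι : #ι ≤ τ)
    (D : ι → Set X) (hD : ∀ i, IsClosed (D i)) (hd : IsDiscreteFamily D) :
    ∃ U : ι → Set X, (∀ i, IsOpen (U i)) ∧ IsDiscreteFamily U ∧ ∀ i, D i ⊆ U i := by
  classical
  obtain ⟨U, hUo, hUd, hU⟩ := hX.exists_expansion (Set.range D)
    (by rintro _ ⟨i, rfl⟩; exact hD i)
    (by
      intro x
      obtain ⟨N, hN, hs⟩ := hd x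
      refine ⟨N, hN, ?_⟩
      rintro ⟨_, i, rfl⟩ hi ⟨_, j, rfl⟩ hj
      rw [hs hi hj])
    (Cardinal.mk_range_le.trans hι)
  -- By discreteness only the empty set can repeat in the family; its copies would share one
  -- expansion, so each gets `∅`.
  refine ⟨fun i => if (D i).Nonempty then U ⟨D i, i, rfl⟩ else ∅, fun i => ?_, fun x => ?_,
    fun i => ?_⟩
  · dsimp only
    split_ifs
    exacts [hUo _, isOpen_empty]
  · obtain ⟨N, hN, hs⟩ := hUd x
    refine ⟨N, hN, fun i hi j hj => ?_⟩
    by_cases h1 : (D i).Nonempty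
    · by_cases h2 : (D j).Nonempty
      · simp only [Set.mem_ofPred_eq, h1, h2, if_true] at hi hj
        have h : D i = D j := congrArg Subtype.val (hs hi hj)
        obtain ⟨y, hy⟩ := h1
        exact hd.eq_of_mem hy (h ▸ hy)
      · simp [h2] at hj
    · simp [h1] at hi
  · dsimp only
    split_ifs with h
    · exact hU ⟨D i, i, rfl⟩
    · exact (Set.not_nonempty_iff_eq_empty.1 h).subset

theorem normalSpace (hX : IsCollectionwiseNormal X τ) (hτ : ℵ₀ ≤ τ) : NormalSpace X := by
  refine ⟨fun s t hs ht hst => ?_⟩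
  obtain ⟨U, hUo, hUd, hU⟩ := hX.exists_indexed_expansion (ι := ULift.{u} Bool)
    ((Cardinal.lt_aleph0_of_finite _).le.trans hτ) (fun b => if b.down then s else t)
    (by rintro ⟨_ | _⟩ <;> simpa)
    (by
      intro x
      by_cases hx : x ∈ s
      · refine ⟨tᶜ, ht.isOpen_compl.mem_nhds (hst.notMem_of_mem_left hx), ?_⟩
        rintro ⟨_ | _⟩ hi ⟨_ | _⟩ hj <;> simp_all
      · refine ⟨sᶜ, hs.isOpen_compl.mem_nhds hx, ?_⟩
        rintro ⟨_ | _⟩ hi ⟨_ | _⟩ hj <;> simp_all)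
  refine ⟨U ⟨true⟩, U ⟨false⟩, hUo _, hUo _, by simpa using hU ⟨true⟩, by simpa using hU ⟨false⟩,
    Set.disjoint_left.2 fun x h1 h2 => ?_⟩
  simpa using hUd.eq_of_mem h1 h2

end IsCollectionwiseNormal

/-! ### Locally finite refinements -/

/-- In a countably paracompact space, open covers indexed by a countable type have precise locally
finite open refinements. -/
theorem IsCountablyParacompact.exists_precise_refinement {X κ : Type*} [TopologicalSpace X]
    [Countable κ] (hX : IsCountablyParacompact X) (U : κ → Set X) (hUo : ∀ k, IsOpen (U k))
    (hU : ⋃ k, U k = Set.univ) :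
    ∃ V : κ → Set X, (∀ k, IsOpen (V k)) ∧ ⋃ k, V k = Set.univ ∧ LocallyFinite V ∧
      ∀ k, V k ⊆ U k := by
  obtain ⟨𝒱, hVo, hVc, hVl, hVU⟩ := hX (Set.range U) (Set.countable_range U)
    (by rintro _ ⟨k, rfl⟩; exact hUo k) (by rwa [Set.sUnion_range])
  have hk : ∀ V : 𝒱, ∃ k, (V : Set X) ⊆ U k := fun V => by
    obtain ⟨_, ⟨k, rfl⟩, h⟩ := hVU V V.2
    exact ⟨k, h⟩
  choose k hk using hk
  refine ⟨fun j => ⋃ V : {V : 𝒱 // k V = j}, (V.1 : Set X),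
    fun j => isOpen_iUnion fun V => hVo _ V.1.2, ?_, fun x => ?_, fun j => ?_⟩
  · refine Set.eq_univ_of_forall fun x => ?_
    obtain ⟨V, hV, hx⟩ := Set.mem_sUnion.1 (hVc ▸ Set.mem_univ x)
    exact Set.mem_iUnion.2 ⟨k ⟨V, hV⟩, Set.mem_iUnion.2 ⟨⟨⟨V, hV⟩, rfl⟩, hx⟩⟩
  · obtain ⟨N, hN, hf⟩ := hVl x
    refine ⟨N, hN, (hf.image k).subset ?_⟩
    rintro j ⟨y, hy, hyN⟩
    obtain ⟨⟨V, rfl⟩, hV⟩ := Set.mem_iUnion.1 hy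
    exact ⟨V, ⟨y, hV, hyN⟩, rfl⟩
  · refine Set.iUnion_subset ?_
    rintro ⟨V, rfl⟩
    exact hk V

/-- Countably many locally finite open families that together cover a closed set `A` of a countably
paracompact space can be shrunk and merged into one locally finite family covering `A`. -/
theorem IsCountablyParacompact.exists_merge {X ι κ : Type*} [TopologicalSpace X] [Countable κ]
    (hX : IsCountablyParacompact X) {A : Set X} (hA : IsClosed A) (V : κ → ι → Set X)
    (hVo : ∀ k i, IsOpen (V k i)) (hVl : ∀ k, LocallyFinite (V k)) (hVA : A ⊆ ⋃ k, ⋃ i, V k i) :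
    ∃ W : ι → Set X, (∀ i, IsOpen (W i)) ∧ LocallyFinite W ∧ (∀ i, W i ⊆ ⋃ k, V k i) ∧
      A ⊆ ⋃ i, W i := by
  obtain ⟨H, hHo, hHc, hHl, hHV⟩ := hX.exists_precise_refinement
    (fun k : Option κ => k.elim Aᶜ fun k => ⋃ i, V k i)
    (by
      rintro (_ | k)
      exacts [hA.isOpen_compl, isOpen_iUnion fun i => hVo k i])
    (by
      refine Set.eq_univ_of_forall fun x => ?_
      by_cases hx : x ∈ A
      · obtain ⟨k, hk⟩ := Set.mem_iUnion.1 (hVA hx)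
        exact Set.mem_iUnion.2 ⟨some k, hk⟩
      · exact Set.mem_iUnion.2 ⟨none, hx⟩)
  refine ⟨fun i => ⋃ k, V k i ∩ H (some k),
    fun i => isOpen_iUnion fun k => (hVo k i).inter (hHo _), fun x => ?_,
    fun i => Set.iUnion_mono fun k => Set.inter_subset_left, fun x hx => ?_⟩
  -- Near `x` only finitely many `H (some k)` occur, and each of these layers is locally finite.
  · obtain ⟨N, hN, hf⟩ := (hHl.comp_injective (Option.some_injective κ)) x
    choose M hM hMf using fun k => hVl k x
    refine ⟨N ∩ ⋂ k ∈ {k | (H (some k) ∩ N).Nonempty}, M k,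
      Filter.inter_mem hN ((Filter.biInter_mem hf).2 fun k _ => hM k),
      (hf.biUnion fun k _ => hMf k).subset ?_⟩
    rintro i ⟨y, hy, hyN, hyM⟩
    obtain ⟨k, hk, hkH⟩ := Set.mem_iUnion.1 hy
    have hkN : k ∈ {k | (H (some k) ∩ N).Nonempty} := ⟨y, hkH, hyN⟩
    exact Set.mem_biUnion hkN ⟨y, hk, Set.mem_iInter₂.1 hyM k hkN⟩
  · obtain ⟨k, hk⟩ := Set.mem_iUnion.1 (hHc ▸ Set.mem_univ x : x ∈ ⋃ k, H k)
    cases k with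
    | none => exact absurd hx (hHV none hk)
    | some k =>
      obtain ⟨i, hi⟩ := Set.mem_iUnion.1 (hHV (some k) hk)
      exact Set.mem_iUnion.2 ⟨i, Set.mem_iUnion.2 ⟨k, hi, hk⟩⟩

namespace IsCollectionwiseNormal

variable {X : Type u} [TopologicalSpace X] {τ : Cardinal.{u}}

/-- Induction on the number of members containing a point. Points of multiplicity `n + 1` not yet
covered split, according to which members contain them, into a discrete closed family, whose
expansion gives one new locally finite layer. -/
theorem exists_seq_locallyFinite (hX : IsCollectionwiseNormal X τ) (hτ : ℵ₀ ≤ τ) {ι : Type u}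
    (hι : #ι ≤ τ) {A : Set X} (hA : IsClosed A) {W : ι → Set X} (hWo : ∀ i, IsOpen (W i))
    (hWA : A ⊆ ⋃ i, W i) (hWf : ∀ x ∈ A, {i | x ∈ W i}.Finite) (n : ℕ) :
    ∃ V : ℕ → ι → Set X, (∀ k i, IsOpen (V k i)) ∧ (∀ k, LocallyFinite (V k)) ∧
      (∀ k i, V k i ⊆ W i) ∧ ∀ x ∈ A, {i | x ∈ W i}.ncard ≤ n → x ∈ ⋃ k, ⋃ i, V k i := by
  induction n with
  | zero =>
    refine ⟨fun _ _ => ∅, fun _ _ => isOpen_empty, fun _ x => ⟨Set.univ, Filter.univ_mem, by simp⟩,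
      fun _ _ => Set.empty_subset _, fun x hx h0 => ?_⟩
    obtain ⟨i, hi⟩ := Set.mem_iUnion.1 (hWA hx)
    rw [Nat.le_zero, Set.ncard_eq_zero (hWf x hx)] at h0
    exact absurd hi (Set.eq_empty_iff_forall_notMem.1 h0 i)
  | succ n ih =>
    obtain ⟨V, hVo, hVl, hVW, hV⟩ := ih
    set G : Set X := ⋃ k, ⋃ i, V k i with hG
    have hGo : IsOpen G := isOpen_iUnion fun k => isOpen_iUnion fun i => hVo k i
    let D : {S : Finset ι // S.card = n + 1} → Set X :=
      fun S => (A \ G) ∩ ⋂ i ∈ (S.1 : Set ι)ᶜ, (W i)ᶜ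
    have hDc : ∀ S, IsClosed (D S) := fun S => (hA.sdiff hGo).inter
      (isClosed_biInter fun i _ => (hWo i).isClosed_compl)
    have hsub : ∀ S, ∀ x ∈ D S, {i | x ∈ W i} ⊆ S.1 := fun S x hx i hi => by
      by_contra h
      exact Set.mem_iInter₂.1 hx.2 i h hi
    have hcard : ∀ x ∈ A \ G, n < {i | x ∈ W i}.ncard := fun x hx => by
      by_contra! h
      exact hx.2 (hV x hx.1 h)
    have hDd : IsDiscreteFamily D := by
      intro x
      by_cases hx : x ∈ A \ G
      -- The members containing `x` persist nearby, so they lie in `S`; there are more than `n` of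
      -- them and `S` has `n + 1` elements, which determines `S`.
      · have key : ∀ S, (D S ∩ ⋂ i ∈ {i | x ∈ W i}, W i).Nonempty → {i | x ∈ W i} = S.1 := by
          rintro S ⟨y, hyD, hy⟩
          have h1 : {i | x ∈ W i} ⊆ S.1 := fun i hi => hsub S y hyD (Set.mem_iInter₂.1 hy i hi)
          refine Set.eq_of_subset_of_ncard_le h1 ?_ S.1.finite_toSet
          rw [Set.ncard_coe_finset, S.2]
          exact hcard x hx
        refine ⟨⋂ i ∈ {i | x ∈ W i}, W i,
          (Filter.biInter_mem (hWf x hx.1)).2 fun i hi => (hWo i).mem_nhds hi, ?_⟩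
        intro S hS T hT
        exact Subtype.ext (Finset.coe_injective ((key S hS).symm.trans (key T hT)))
      · refine ⟨(A \ G)ᶜ, (hA.sdiff hGo).isOpen_compl.mem_nhds hx, ?_⟩
        rintro S ⟨y, hy, hy'⟩
        exact absurd hy.1 hy'
    have hfin : #{S : Finset ι // S.card = n + 1} ≤ τ := by
      refine (Cardinal.mk_subtype_le _).trans ?_
      rcases finite_or_infinite ι with h | h
      · exact (Cardinal.lt_aleph0_of_finite _).le.trans hτ
      · rwa [Cardinal.mk_finset_of_infinite]
    obtain ⟨U, hUo, hUd, hU⟩ := hX.exists_indexed_expansion hfin D hDc hDd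
    -- Layer 0 is new and the old layers shift by one. Each `U S` is shared among all `i ∈ S`;
    -- finiteness of `S` keeps the layer locally finite.
    refine ⟨fun k i => k.casesOn ((⋃ S : {S : {S : Finset ι // S.card = n + 1} // i ∈ S.1}, U S.1)
      ∩ W i) fun k => V k i, ?_, ?_, ?_, fun x hx hn => ?_⟩
    · rintro (_ | k) i
      exacts [(isOpen_iUnion fun S => hUo _).inter (hWo i), hVo k i]
    · rintro (_ | k)
      · intro x
        obtain ⟨N, hN, hs⟩ := hUd x
        refine ⟨N, hN, ?_⟩
        refine (hs.finite.biUnion fun S _ => S.1.finite_toSet).subset ?_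
        rintro i ⟨y, ⟨hy, -⟩, hyN⟩
        obtain ⟨⟨S, hiS⟩, hy⟩ := Set.mem_iUnion.1 hy
        exact Set.mem_biUnion (show S ∈ {S | (U S ∩ N).Nonempty} from ⟨y, hy, hyN⟩) hiS
      · exact hVl k
    · rintro (_ | k) i
      exacts [Set.inter_subset_right, hVW k i]
    · by_cases hxG : x ∈ G
      · obtain ⟨k, hk⟩ := Set.mem_iUnion.1 hxG
        exact Set.mem_iUnion.2 ⟨k + 1, hk⟩
      · let S : {S : Finset ι // S.card = n + 1} := ⟨(hWf x hx).toFinset, by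
          rw [← Set.ncard_eq_toFinset_card _ (hWf x hx)]
          exact le_antisymm hn (hcard x ⟨hx, hxG⟩)⟩
        obtain ⟨i, hi⟩ := Set.mem_iUnion.1 (hWA hx)
        have hxD : x ∈ D S := by
          refine ⟨⟨hx, hxG⟩, Set.mem_iInter₂.2 fun j hj hxj => hj ?_⟩
          simpa [S] using hxj
        refine Set.mem_iUnion.2 ⟨0, Set.mem_iUnion.2 ⟨i, Set.mem_iUnion.2 ⟨⟨S, ?_⟩, hU S hxD⟩, hi⟩⟩
        simpa [S] using hi

/-- Michael–Nagami: point-finite open covers of closed sets have precise locally finite open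
refinements. -/
theorem exists_locallyFinite_refinement (hX : IsCollectionwiseNormal X τ)
    (hc : IsCountablyParacompact X) (hτ : ℵ₀ ≤ τ) {ι : Type u}
    (hι : #ι ≤ τ) {A : Set X} (hA : IsClosed A) {W : ι → Set X} (hWo : ∀ i, IsOpen (W i))
    (hWA : A ⊆ ⋃ i, W i) (hWf : ∀ x ∈ A, {i | x ∈ W i}.Finite) :
    ∃ V : ι → Set X, (∀ i, IsOpen (V i)) ∧ LocallyFinite V ∧ (∀ i, V i ⊆ W i) ∧
      A ⊆ ⋃ i, V i := by
  choose V hVo hVl hVW hV using hX.exists_seq_locallyFinite hτ hι hA hWo hWA hWf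
  obtain ⟨V', h1, h2, h3, h4⟩ := hc.exists_merge hA (fun p : ℕ × ℕ => V p.1 p.2)
    (fun p => hVo p.1 p.2) (fun p => hVl p.1 p.2) (fun x hx => by
      obtain ⟨k, hk⟩ := Set.mem_iUnion.1 (hV _ x hx le_rfl)
      exact Set.mem_iUnion.2 ⟨(_, k), hk⟩)
  exact ⟨V', h1, h2, fun i => (h3 i).trans (Set.iUnion_subset fun p => hVW _ _ i), h4⟩

end IsCollectionwiseNormal

/-! ### Lower semi-continuity with moving test sets, and weight -/

theorem LowerHemicontinuous.isOpen_exists_mem {X E : Type*} [TopologicalSpace X]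
    [TopologicalSpace E] {φ : X → Set E} (hφ : LowerHemicontinuous φ) {O : Set (X × E)}
    (hO : IsOpen O) : IsOpen {x | ∃ y ∈ φ x, (x, y) ∈ O} := by
  rw [lowerHemicontinuous_iff_isOpen_inter_nonempty] at hφ
  refine isOpen_iff_mem_nhds.2 ?_
  rintro x ⟨y, hy, hxy⟩
  obtain ⟨u, v, hu, hv, hxu, hyv, huv⟩ := isOpen_prod_iff.1 hO x y hxy
  filter_upwards [hu.mem_nhds hxu, (hφ v hv).mem_nhds ⟨y, hy, hyv⟩]
  rintro x' hx' ⟨y', hy', hv'⟩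
  exact ⟨y', hy', huv ⟨hx', hv'⟩⟩

theorem exists_dense_mk_le_topologicalWeight (E : Type u) [TopologicalSpace E] :
    ∃ s : Set E, Dense s ∧ #s ≤ topologicalWeight E := by
  obtain ⟨B, hB, hBc⟩ : topologicalWeight E ∈
      {κ | ∃ B : Set (Set E), TopologicalSpace.IsTopologicalBasis B ∧ #B = κ} :=
    csInf_mem ⟨_, _, TopologicalSpace.isTopologicalBasis_opens, rfl⟩
  have h : ∀ b : {b : B // (b : Set E).Nonempty}, ∃ y, y ∈ (b.1 : Set E) := fun b => b.2
  choose y hy using h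
  refine ⟨Set.range y, ?_, (Cardinal.mk_range_le.trans (Cardinal.mk_subtype_le _)).trans hBc.le⟩
  rw [hB.dense_iff]
  exact fun o ho hne => ⟨y ⟨⟨o, ho⟩, hne⟩, hy ⟨⟨o, ho⟩, hne⟩, Set.mem_range_self _⟩

/-- Paracompactness of metric spaces, applied to balls centred on a dense set, whose size bounds the
index set. -/
theorem exists_locallyFinite_cover_dist_lt (E : Type u) [MetricSpace E] {ε : ℝ} (hε : 0 < ε) :
    ∃ (ι : Type u) (U : ι → Set E), #ι ≤ topologicalWeight E ∧ (∀ i, IsOpen (U i)) ∧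
      LocallyFinite U ∧ ⋃ i, U i = Set.univ ∧ ∀ i, ∀ y ∈ U i, ∀ z ∈ U i, dist y z < ε := by
  obtain ⟨s, hs, hsc⟩ := exists_dense_mk_le_topologicalWeight E
  obtain ⟨U, hUo, hUc, hUl, hU⟩ := precise_refinement (fun y : s => Metric.ball (y : E) (ε / 2))
    (fun _ => Metric.isOpen_ball) (by
      refine Set.eq_univ_of_forall fun x => ?_
      obtain ⟨y, hy, hxy⟩ := hs.exists_dist_lt x (half_pos hε)
      exact Set.mem_iUnion.2 ⟨⟨y, hy⟩, hxy⟩)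
  refine ⟨s, U, hsc, hUo, hUl, hUc, fun i y hy z hz => ?_⟩
  have h1 := Metric.mem_ball.1 (hU i hy)
  have h2 := Metric.mem_ball'.1 (hU i hz)
  linarith [dist_triangle y i z]

/-! ### Michael's iteration inside the unit ball -/

section UnitBall

variable {X E : Type u} [TopologicalSpace X] [NormedAddCommGroup E]
  [NormedSpace ℝ E] {τ : Cardinal.{u}} {φ : X → Set E}

/-- An approximate selection with values in the open unit ball can be improved. -/
theorem exists_approxSelection_unitBall_step (hX : IsCollectionwiseNormal X τ)
    (hc : IsCountablyParacompact X) (hτ : ℵ₀ ≤ τ) (hE : topologicalWeight E ≤ τ)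
    (hφ : ∀ x, φ x ∈ compactsOrUniv E) (hl : LowerHemicontinuous φ) (hconv : ∀ x, Convex ℝ (φ x))
    {f : X → E} (hf : Continuous f) {δ ε : ℝ} (hδ : 0 < δ) (hε : 0 < ε)
    (hfb : ∀ x, f x ∈ Metric.ball (0 : E) 1)
    (hfφ : ∀ x, (φ x ∩ (Metric.ball 0 1 ∩ Metric.ball (f x) δ)).Nonempty) :
    ∃ f' : X → E, Continuous f' ∧ (∀ x, f' x ∈ Metric.ball (0 : E) 1) ∧
      (∀ x, (φ x ∩ (Metric.ball 0 1 ∩ Metric.ball (f' x) ε)).Nonempty) ∧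
      ∀ x, dist (f x) (f' x) ≤ δ + ε := by
  classical
  have := hX.normalSpace hτ
  obtain ⟨ι, U, hι, hUo, hUl, hUc, hUε⟩ := exists_locallyFinite_cover_dist_lt E hε
  let Φ : X → Set E := fun x => φ x ∩ (Metric.ball 0 1 ∩ Metric.ball (f x) δ)
  let W : ι → Set X := fun i => {x | (Φ x ∩ U i).Nonempty}
  have hWo : ∀ i, IsOpen (W i) := fun i => by
    have hO : IsOpen {p : X × E | p.2 ∈ Metric.ball (0 : E) 1 ∧ dist p.2 (f p.1) < δ ∧ p.2 ∈ U i} :=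
      (Metric.isOpen_ball.preimage continuous_snd).inter
        ((isOpen_lt (continuous_snd.dist (hf.comp continuous_fst)) continuous_const).inter
          ((hUo i).preimage continuous_snd))
    convert! hl.isOpen_exists_mem hO using 1
    ext x
    constructor
    · rintro ⟨y, ⟨h1, h2, h3⟩, h4⟩
      exact ⟨y, h1, h2, h3, h4⟩
    · rintro ⟨y, h1, h2, h3, h4⟩
      exact ⟨y, ⟨h1, h2, h3⟩, h4⟩
  have hWc : ∀ x, ∃ i, x ∈ W i := fun x => by
    obtain ⟨y, hy⟩ := hfφ x
    obtain ⟨i, hi⟩ := Set.mem_iUnion.1 (hUc ▸ Set.mem_univ y)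
    exact ⟨i, y, hy, hi⟩
  -- These sets handle the full values: if `φ x` is all of `E`, then `f x` itself lies in `Φ x`, so
  -- `x` is in some `Z i`.
  let Z : ι → Set X := fun i => f ⁻¹' U i ∩ W i
  have hZo : ∀ i, IsOpen (Z i) := fun i => ((hUo i).preimage hf).inter (hWo i)
  have hZl : LocallyFinite Z := (hUl.preimage_continuous hf).subset fun i => Set.inter_subset_left
  have hfin : ∀ x ∈ (⋃ i, Z i)ᶜ, {i | x ∈ W i}.Finite := by
    intro x hx
    rcases hφ x with ⟨-, -, hK⟩ | h
    · refine (hUl.finite_nonempty_inter_compact hK).subset ?_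
      rintro i ⟨y, hy, hyU⟩
      exact ⟨y, hyU, hy.1⟩
    · obtain ⟨i, hi⟩ := Set.mem_iUnion.1 (hUc ▸ Set.mem_univ (f x))
      have hxφ : f x ∈ φ x := Set.mem_singleton_iff.1 h ▸ Set.mem_univ _
      have hxZ : x ∈ Z i := ⟨hi, f x, ⟨hxφ, hfb x, Metric.mem_ball_self hδ⟩, hi⟩
      exact absurd (Set.mem_iUnion.2 ⟨i, hxZ⟩) hx
  obtain ⟨V, hVo, hVl, hVW, hVc⟩ := hX.exists_locallyFinite_refinement hc hτ (hι.trans hE)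
    (isOpen_iUnion hZo).isClosed_compl hWo (fun x _ => Set.mem_iUnion.2 (hWc x)) hfin
  obtain ⟨p, hp⟩ := PartitionOfUnity.exists_isSubordinate_of_locallyFinite isClosed_univ
    (fun i => V i ∪ Z i) (fun i => (hVo i).union (hZo i)) (fun x => by
      obtain ⟨N, hN, hNf⟩ := hVl x
      obtain ⟨M, hM, hMf⟩ := hZl x
      refine ⟨N ∩ M, Filter.inter_mem hN hM, (hNf.union hMf).subset ?_⟩
      rintro i ⟨y, hy | hy, hyN, hyM⟩
      exacts [Or.inl ⟨y, hy, hyN⟩, Or.inr ⟨y, hy, hyM⟩]) (fun x _ => by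
      by_cases hx : x ∈ ⋃ i, Z i
      · obtain ⟨i, hi⟩ := Set.mem_iUnion.1 hx
        exact Set.mem_iUnion.2 ⟨i, Or.inr hi⟩
      · obtain ⟨i, hi⟩ := Set.mem_iUnion.1 (hVc hx)
        exact Set.mem_iUnion.2 ⟨i, Or.inl hi⟩)
  have hpW : ∀ i x, p i x ≠ 0 → x ∈ W i := fun i x hx =>
    (hp i (subset_closure hx)).elim (fun h => hVW i h) fun h => h.2
  -- The default 0 never gets positive weight: `p i x ≠ 0` makes `U i` meet `Φ x`, hence the open
  -- unit ball.
  have hy : ∀ i, ∃ y : E, y ∈ Metric.ball (0 : E) 1 ∧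
      ((U i ∩ Metric.ball (0 : E) 1).Nonempty → y ∈ U i) := fun i => by
    by_cases h : (U i ∩ Metric.ball (0 : E) 1).Nonempty
    · exact ⟨h.choose, h.choose_spec.2, fun _ => h.choose_spec.1⟩
    · exact ⟨0, by simp, fun h' => absurd h' h⟩
  choose y hyb hyU using hy
  have hmem : ∀ x, (∑ᶠ i, p i x • y i) ∈ Metric.thickening ε (Φ x) := fun x => by
    refine p.finsum_smul_mem_convex (g := fun i _ => y i) (Set.mem_univ x) (fun i hi => ?_)
      (((hconv x).inter ((convex_ball _ _).inter (convex_ball _ _))).thickening ε)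
    obtain ⟨z, hz, hzU⟩ := hpW i x hi
    exact Metric.mem_thickening_iff.2 ⟨z, hz, hUε i _ (hyU i ⟨z, hzU, hz.2.1⟩) _ hzU⟩
  refine ⟨fun x => ∑ᶠ i, p i x • y i, p.continuous_finsum_smul fun i x _ => continuousAt_const,
    fun x => p.finsum_smul_mem_convex (g := fun i _ => y i) (Set.mem_univ x) (fun i _ => hyb i)
      (convex_ball _ _), fun x => ?_, fun x => ?_⟩
  · obtain ⟨z, hz, hd⟩ := Metric.mem_thickening_iff.1 (hmem x)
    exact ⟨z, hz.1, hz.2.1, Metric.mem_ball'.2 hd⟩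
  · obtain ⟨z, hz, hd⟩ := Metric.mem_thickening_iff.1 (hmem x)
    have h1 := Metric.mem_ball'.1 hz.2.2
    rw [dist_comm] at hd
    exact (dist_triangle _ z _).trans (add_le_add h1.le hd.le)

/-- A lower semi-continuous convex map with compact or full values, all of which meet the open unit
ball, has a selection with values in the closed unit ball. -/
theorem exists_selection_norm_le_one [CompleteSpace E] (hX : IsCollectionwiseNormal X τ)
    (hc : IsCountablyParacompact X) (hτ : ℵ₀ ≤ τ) (hE : topologicalWeight E ≤ τ)
    (hφ : ∀ x, φ x ∈ compactsOrUniv E) (hl : LowerHemicontinuous φ) (hconv : ∀ x, Convex ℝ (φ x))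
    (hb : ∀ x, (φ x ∩ Metric.ball 0 1).Nonempty) :
    ∃ f : X → E, Continuous f ∧ IsSelection f φ ∧ ∀ x, ‖f x‖ ≤ 1 := by
  let P : ℕ → (X → E) → Prop := fun n f => Continuous f ∧ (∀ x, f x ∈ Metric.ball (0 : E) 1) ∧
    ∀ x, (φ x ∩ (Metric.ball 0 1 ∩ Metric.ball (f x) ((1 / 2) ^ n))).Nonempty
  -- Here `δ + ε` is `3/2 * (1/2)^n`, rounded up to `2 * (1/2)^n`.
  have hstep : ∀ n, ∀ f : {f // P n f}, ∃ f' : {f // P (n + 1) f},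
      ∀ x, dist (f.1 x) (f'.1 x) ≤ 2 * (1 / 2) ^ n := by
    rintro n ⟨f, hf, hfb, hfφ⟩
    obtain ⟨f', h1, h2, h3, h4⟩ := exists_approxSelection_unitBall_step hX hc hτ hE hφ hl hconv hf
      (δ := (1 / 2) ^ n) (ε := (1 / 2) ^ (n + 1)) (by positivity) (by positivity) hfb hfφ
    refine ⟨⟨f', h1, h2, h3⟩, fun x => (h4 x).trans ?_⟩
    have : (0 : ℝ) < (1 / 2) ^ n := by positivity
    rw [pow_succ]
    linarith
  choose next hnext using hstep
  let F : ∀ n, {f // P n f} := fun n => Nat.rec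
    ⟨fun _ => 0, continuous_const, fun _ => by simp, fun x => by simpa using hb x⟩ next n
  have hF : ∀ x n, dist ((F n).1 x) ((F (n + 1)).1 x) ≤ 2 * (1 / 2) ^ n :=
    fun x n => hnext n (F n) x
  choose f hf using fun x => cauchySeq_tendsto_of_complete
    (cauchySeq_of_le_geometric (1 / 2) 2 (by norm_num) (hF x))
  have hdist : ∀ x n, dist ((F n).1 x) (f x) ≤ 4 * (1 / 2) ^ n := fun x n => by
    refine (dist_le_of_le_geometric_of_tendsto (1 / 2) 2 (by norm_num) (hF x) (hf x) n).trans ?_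
    norm_num
    linarith
  have hlim : ∀ C : ℝ, Filter.Tendsto (fun n : ℕ => C * (1 / 2 : ℝ) ^ n) Filter.atTop (𝓝 0) :=
    fun C => by
      have h := (tendsto_pow_atTop_nhds_zero_of_lt_one (r := (1 / 2 : ℝ))
        (by norm_num) (by norm_num)).const_mul C
      rwa [mul_zero] at h
  refine ⟨f, ?_, fun x => ?_, fun x => ?_⟩
  · refine TendstoUniformly.continuous (F := fun n => (F n).1) (p := Filter.atTop) ?_
      (Filter.Frequently.of_forall fun n => (F n).2.1)
    refine Metric.tendstoUniformly_iff.2 fun ε hε => ?_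
    filter_upwards [(hlim 4).eventually_lt_const hε] with n hn x
    rw [dist_comm]
    exact (hdist x n).trans_lt hn
  · have hcl : IsClosed (φ x) := by
      rcases hφ x with h | h
      · exact h.2.1
      · rw [Set.mem_singleton_iff.1 h]
        exact isClosed_univ
    choose z hz using fun n => (F n).2.2.2 x
    refine hcl.mem_of_tendsto (b := Filter.atTop) (f := z) ?_ (Filter.Eventually.of_forall fun n =>
      (hz n).1)
    refine (tendsto_iff_of_dist (squeeze_zero (fun n => dist_nonneg) (fun n =>
      (Metric.mem_ball'.1 (hz n).2.2).le) ?_)).1 (hf x)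
    exact (hlim 1).congr fun n => one_mul _
  · refine le_of_tendsto (hf x).norm (Filter.Eventually.of_forall fun n => ?_)
    exact (mem_ball_zero_iff.1 ((F n).2.2.1 x)).le

end UnitBall

/-! ### Variable tolerance by rescaling -/

/-- Strict insertion of a continuous function between the distance to a lower semi-continuous map
and a lower semi-continuous function. -/
theorem exists_continuous_infDist_lt_lt {X E : Type*} [TopologicalSpace X] [NormalSpace X]
    (hc : IsCountablyParacompact X) [PseudoMetricSpace E] {φ : X → Set E}
    (hne : ∀ x, (φ x).Nonempty) (hl : LowerHemicontinuous φ) {η : X → ℝ}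
    (hη : LowerSemicontinuous η) {g : X → E} (hg : Continuous g) (h : IsApproxSelection g η φ) :
    ∃ α : X → ℝ, Continuous α ∧ ∀ x, Metric.infDist (g x) (φ x) < α x ∧ α x < η x := by
  have hO : ∀ q : ℚ, IsOpen {x | Metric.infDist (g x) (φ x) < q ∧ (q : ℝ) < η x} := fun q => by
    have hO : IsOpen {p : X × E | dist (g p.1) p.2 < q} := isOpen_lt (by fun_prop) continuous_const
    have h1 : {x | Metric.infDist (g x) (φ x) < q} =
        {x | ∃ y ∈ φ x, (x, y) ∈ {p : X × E | dist (g p.1) p.2 < q}} :=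
      Set.ext fun x => Metric.infDist_lt_iff (hne x)
    have h2 : IsOpen {x | Metric.infDist (g x) (φ x) < q} := h1 ▸ hl.isOpen_exists_mem hO
    exact h2.inter (hη.isOpen_preimage q)
  obtain ⟨V, hVo, hVc, hVl, hV⟩ := hc.exists_precise_refinement _ hO (by
    refine Set.eq_univ_of_forall fun x => ?_
    obtain ⟨q, hq⟩ := exists_rat_btwn (h x)
    exact Set.mem_iUnion.2 ⟨q, hq⟩)
  obtain ⟨p, hp⟩ := PartitionOfUnity.exists_isSubordinate_of_locallyFinite isClosed_univ V hVo hVl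
    hVc.ge
  -- Every rational with nonzero weight at `x` lies strictly between the two bounds, and so does
  -- their convex combination.
  exact ⟨fun x => ∑ᶠ q, p q x • (q : ℝ), p.continuous_finsum_smul fun i x _ => continuousAt_const,
    fun x => p.finsum_smul_mem_convex (g := fun q _ => (q : ℝ)) (Set.mem_univ x)
      (fun q hq => hV q (hp q (subset_closure hq))) (convex_Ioo _ _)⟩

theorem compactsOrUniv_nonempty {E : Type*} [TopologicalSpace E] [Nonempty E] {S : Set E}
    (h : S ∈ compactsOrUniv E) : S.Nonempty := by
  rcases h with h | h
  · exact h.1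
  · rw [Set.mem_singleton_iff.1 h]
    exact Set.univ_nonempty

theorem exists_selection_dist_lt {X E : Type u} [TopologicalSpace X] [NormedAddCommGroup E]
    [NormedSpace ℝ E] [CompleteSpace E] {τ : Cardinal.{u}} (hX : IsCollectionwiseNormal X τ)
    (hc : IsCountablyParacompact X) (hτ : ℵ₀ ≤ τ) (hE : topologicalWeight E ≤ τ)
    {φ : X → Set E} {η : X → ℝ} {g : X → E}
    (hφ : ∀ x, φ x ∈ compactsOrUniv E) (hl : LowerHemicontinuous φ) (hconv : ∀ x, Convex ℝ (φ x))
    (hη : LowerSemicontinuous η) (hg : Continuous g) (hgφ : IsApproxSelection g η φ) :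
    ∃ f : X → E, Continuous f ∧ IsSelection f φ ∧ ∀ x, dist (f x) (g x) < η x := by
  have := hX.normalSpace hτ
  have hne : ∀ x, (φ x).Nonempty := fun x => compactsOrUniv_nonempty (hφ x)
  obtain ⟨α, hα, hαφ⟩ := exists_continuous_infDist_lt_lt hc hne hl hη hg hgφ
  have hα0 : ∀ x, 0 < α x := fun x => Metric.infDist_nonneg.trans_lt (hαφ x).1
  have hα0' : ∀ x, α x ≠ 0 := fun x => (hα0 x).ne'
  have hcont : ∀ x, Continuous fun y : E => (α x)⁻¹ • (y - g x) := fun x => by fun_prop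
  obtain ⟨f, hf, hfφ, hf1⟩ := exists_selection_norm_le_one hX hc hτ hE
    (φ := fun x => (fun y => (α x)⁻¹ • (y - g x)) '' φ x)
    (fun x => by
      rcases hφ x with h | h
      · exact Or.inl ⟨h.1.image _, (h.2.2.image (hcont x)).isClosed, h.2.2.image (hcont x)⟩
      · refine Or.inr (Set.mem_singleton_iff.2 ?_)
        rw [Set.mem_singleton_iff.1 h, Set.image_univ, Set.range_eq_univ]
        exact fun z => ⟨g x + α x • z, by simp [smul_smul, inv_mul_cancel₀ (hα0' x)]⟩)
    (by
      refine lowerHemicontinuous_iff_isOpen_inter_nonempty.2 fun U hU => ?_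
      have hO : IsOpen {p : X × E | (α p.1)⁻¹ • (p.2 - g p.1) ∈ U} := by
        refine hU.preimage (Continuous.smul ?_ (by fun_prop))
        exact (hα.comp continuous_fst).inv₀ fun p => hα0' p.1
      convert! hl.isOpen_exists_mem hO using 1
      ext x
      simp [Set.inter_nonempty])
    (fun x => by
      rintro _ ⟨y, hy, rfl⟩ _ ⟨z, hz, rfl⟩ a b ha hb hab
      refine ⟨a • y + b • z, hconv x hy hz ha hb hab, ?_⟩
      obtain rfl : b = 1 - a := by linarith
      dsimp only
      module)
    (fun x => by
      obtain ⟨y, hy, hd⟩ := (Metric.infDist_lt_iff (hne x)).1 (hαφ x).1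
      refine ⟨_, ⟨y, hy, rfl⟩, ?_⟩
      rw [mem_ball_zero_iff, norm_smul, norm_inv, Real.norm_of_nonneg (hα0 x).le,
        inv_mul_lt_one₀ (hα0 x), ← dist_eq_norm, dist_comm]
      exact hd)
  refine ⟨fun x => g x + α x • f x, hg.add (hα.smul hf), fun x => ?_, fun x => ?_⟩
  · obtain ⟨y, hy, hyf⟩ := hfφ x
    dsimp only at hyf ⊢
    rw [← hyf, smul_smul, mul_inv_cancel₀ (hα0' x), one_smul, add_sub_cancel]
    exact hy
  · rw [dist_eq_norm, add_sub_cancel_left, norm_smul, Real.norm_of_nonneg (hα0 x).le]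
    -- The closed-ball bound suffices because `α x < η x` is strict.
    exact (mul_le_of_le_one_right (hα0 x).le (hf1 x)).trans_lt (hαφ x).2

/-! ### Weight of the test spaces -/

theorem topologicalWeight_le_of_dense {E : Type u} [PseudoMetricSpace E] {s : Set E} (hs : Dense s)
    {τ : Cardinal.{u}} (hτ : ℵ₀ ≤ τ) (hsτ : #s ≤ τ) : topologicalWeight E ≤ τ := by
  let b : s × ℚ → Set E := fun p => Metric.ball (p.1 : E) p.2
  have hb : TopologicalSpace.IsTopologicalBasis (Set.range b) := by
    refine TopologicalSpace.isTopologicalBasis_of_isOpen_of_nhds ?_ fun x U hx hU => ?_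
    · rintro _ ⟨p, rfl⟩
      exact Metric.isOpen_ball
    · obtain ⟨ε, hε, hεU⟩ := Metric.isOpen_iff.1 hU x hx
      obtain ⟨q, hq0, hq⟩ := exists_rat_btwn (half_pos hε)
      obtain ⟨y, hy, hxy⟩ := hs.exists_dist_lt x hq0
      refine ⟨_, ⟨(⟨y, hy⟩, q), rfl⟩, hxy, fun z hz => hεU ?_⟩
      have hzy : dist z y < q := hz
      rw [Metric.mem_ball]
      linarith [dist_triangle z y x, dist_comm x y]
  have hle : topologicalWeight E ≤ #(Set.range b) := csInf_le' ⟨Set.range b, hb, rfl⟩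
  refine hle.trans (Cardinal.mk_range_le.trans ?_)
  rw [Cardinal.mk_prod, Cardinal.lift_uzero, Cardinal.mk_eq_aleph0 ℚ, Cardinal.lift_aleph0]
  exact Cardinal.mul_le_of_le hτ hsτ hτ

/-- Finite sums of rational multiples of unit vectors are dense. -/
theorem topologicalWeight_lp_le {ι : Type u} {τ : Cardinal.{u}} (hτ : ℵ₀ ≤ τ) (hι : #ι ≤ τ) :
    topologicalWeight (lp (fun _ : ι => ℝ) 1) ≤ τ := by
  classical
  let e : ι × ℚ → lp (fun _ : ι => ℝ) 1 := fun p => lp.single 1 p.1 (p.2 : ℝ)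
  let M := AddSubmonoid.closure (Set.range e)
  refine topologicalWeight_le_of_dense (s := (M : Set (lp (fun _ : ι => ℝ) 1))) (fun x => ?_) hτ ?_
  · have hM : ∀ (i : ι) (r : ℝ), lp.single 1 i r ∈ M.topologicalClosure := fun i r => by
      have hc : Continuous fun r : ℝ => (lp.single 1 i r : lp (fun _ : ι => ℝ) 1) := by
        have : (fun r : ℝ => (lp.single 1 i r : lp (fun _ : ι => ℝ) 1)) =
            fun r => r • lp.single 1 i (1 : ℝ) := by
          funext r
          rw [← lp.single_smul, smul_eq_mul, mul_one]
        rw [this]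
        fun_prop
      refine map_mem_closure hc (Rat.denseRange_cast r) ?_
      rintro _ ⟨q, rfl⟩
      exact AddSubmonoid.subset_closure ⟨(i, q), rfl⟩
    exact M.isClosed_topologicalClosure.mem_of_tendsto (lp.hasSum_single ENNReal.one_ne_top x)
      (Filter.Eventually.of_forall fun s => sum_mem fun i _ => hM i (x i))
  · have hsub : (M : Set (lp (fun _ : ι => ℝ) 1)) ⊆
        Set.range fun l : List (ι × ℚ) => (l.map e).sum := fun x hx => by
      obtain ⟨l, hl, rfl⟩ := AddSubmonoid.exists_list_of_mem_closure hx
      obtain ⟨l, rfl⟩ : l ∈ Set.range (List.map e) := by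
        rw [Set.range_list_map]
        exact hl
      exact ⟨l, rfl⟩
    refine (Cardinal.mk_le_mk_of_subset hsub).trans (Cardinal.mk_range_le.trans
      ((Cardinal.mk_list_le_max _).trans (max_le hτ ?_)))
    rw [Cardinal.mk_prod, Cardinal.lift_uzero, Cardinal.mk_eq_aleph0 ℚ, Cardinal.lift_aleph0]
    exact Cardinal.mul_le_of_le hτ hι hτ

/-! ### Necessity of the topological conditions -/

/-- Every lower semi-continuous convex map with compact or full values into a Banach space of weight
at most `τ` has continuous selections strictly `η`-close to any continuous `η`-selection. -/
def HasControlledSelections (X : Type u) [TopologicalSpace X] (τ : Cardinal.{u}) : Prop :=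
  ∀ (E : Type u) [NormedAddCommGroup E] [NormedSpace ℝ E] [CompleteSpace E],
    topologicalWeight E ≤ τ →
    ∀ (φ : X → Set E) (η : X → ℝ) (g : X → E),
      (∀ x, φ x ∈ compactsOrUniv E) → LowerHemicontinuous φ → (∀ x, Convex ℝ (φ x)) →
      LowerSemicontinuous η → (∀ x, 0 < η x) →
      Continuous g → IsApproxSelection g η φ →
      ∃ f : X → E, Continuous f ∧ IsSelection f φ ∧ ∀ x, dist (f x) (g x) < η x

namespace HasControlledSelections

variable {X : Type u} [TopologicalSpace X] {τ : Cardinal.{u}}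

theorem isCollectionwiseNormal [T1Space X] (hX : HasControlledSelections X τ) (hτ : ℵ₀ ≤ τ) :
    IsCollectionwiseNormal X τ := by
  classical
  refine ⟨inferInstance, fun 𝒟 hDc hDd hDτ => ?_⟩
  let e : 𝒟 → lp (fun _ : 𝒟 => ℝ) 1 := fun D => lp.single 1 D (1 : ℝ)
  let φ : X → Set (lp (fun _ : 𝒟 => ℝ) 1) := fun x => {y | ∀ D : 𝒟, x ∈ (D : Set X) → y = e D}
  have hφD : ∀ (D : 𝒟) (x : X), x ∈ (D : Set X) → φ x = {e D} := fun D x hx => by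
    ext y
    refine ⟨fun h => h D hx, ?_⟩
    rintro rfl D' hD'
    rw [hDd.eq_of_mem hx hD']
  have hφu : ∀ x, (∀ D : 𝒟, x ∉ (D : Set X)) → φ x = Set.univ := fun x hx =>
    Set.eq_univ_of_forall fun y D hD => absurd hD (hx D)
  have hcase : ∀ x, (∃ D : 𝒟, φ x = {e D}) ∨ φ x = Set.univ := fun x => by
    by_cases h : ∃ D : 𝒟, x ∈ (D : Set X)
    · obtain ⟨D, hD⟩ := h
      exact Or.inl ⟨D, hφD D x hD⟩
    · exact Or.inr (hφu x (not_exists.1 h))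
  have hlsc : LowerHemicontinuous φ := by
    refine lowerHemicontinuous_iff_isOpen_inter_nonempty.2 fun U hU => isOpen_iff_mem_nhds.2 ?_
    rintro x ⟨y, hy, hyU⟩
    have hlf : LocallyFinite fun D : 𝒟 => (D : Set X) := fun x =>
      (hDd x).imp fun N h => ⟨h.1, h.2.finite⟩
    filter_upwards [hlf.iInter_compl_mem_nhds (fun D => hDc D D.2) x] with z hz
    refine ⟨y, fun D hD => hy D ?_, hyU⟩
    by_contra hx
    exact Set.mem_iInter₂.1 hz D hx hD
  obtain ⟨f, hf, hfφ, -⟩ := hX (lp (fun _ : 𝒟 => ℝ) 1) (topologicalWeight_lp_le hτ hDτ) φ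
    -- Any constant above `‖e D‖ = 1` makes zero an approximate selection.
    (fun _ => 2) (fun _ => 0)
    (fun x => by
      rcases hcase x with ⟨D, h⟩ | h
      · rw [h]
        exact Or.inl ⟨Set.singleton_nonempty _, isClosed_singleton, isCompact_singleton⟩
      · exact Or.inr h)
    hlsc
    (fun x => by
      rcases hcase x with ⟨D, h⟩ | h
      · rw [h]
        exact convex_singleton _
      · rw [h]
        exact convex_univ)
    lowerSemicontinuous_const (fun _ => two_pos) continuous_const
    (fun x => by
      rcases hcase x with ⟨D, h⟩ | h
      · rw [h, Metric.infDist_singleton, dist_zero_left, lp.norm_single (by norm_num)]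
        norm_num
      · rw [h, Metric.infDist_zero_of_mem (Set.mem_univ _)]
        exact two_pos)
  have hdist : ∀ D D' : 𝒟, D ≠ D' → 1 ≤ dist (e D) (e D') := fun D D' h => by
    rw [dist_eq_norm]
    refine le_trans ?_ (lp.norm_apply_le_norm one_ne_zero _ D)
    simp [e, h]
  -- Two members meeting one neighbourhood would put their unit vectors less than `4 * (1/4) = 1`
  -- apart.
  refine ⟨fun D => f ⁻¹' Metric.ball (e D) (1 / 4), fun D => Metric.isOpen_ball.preimage hf,
    fun x => ⟨f ⁻¹' Metric.ball (f x) (1 / 4),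
      hf.continuousAt.preimage_mem_nhds (Metric.ball_mem_nhds _ (by norm_num)), ?_⟩,
    fun D x hx => ?_⟩
  · rintro D ⟨y, hy, hyx⟩ D' ⟨y', hy', hyx'⟩
    by_contra h
    have h0 := hdist D D' h
    have h1 : dist (f y) (e D) < 1 / 4 := hy
    have h2 : dist (f y) (f x) < 1 / 4 := hyx
    have h3 : dist (f y') (e D') < 1 / 4 := hy'
    have h4 : dist (f y') (f x) < 1 / 4 := hyx'
    have h5 := dist_triangle4 (e D) (f y) (f x) (e D')
    have h6 := dist_triangle (f x) (f y') (e D')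
    rw [dist_comm (e D) (f y)] at h5
    rw [dist_comm (f x) (f y')] at h6
    linarith
  · have hfx : f x = e D := hfφ x D hx
    simp [hfx]

theorem isCountablyParacompact (hX : HasControlledSelections X τ) (hτ : ℵ₀ ≤ τ) :
    IsCountablyParacompact X := by
  classical
  intro 𝒰 h𝒰 hUo hUc
  rcases 𝒰.eq_empty_or_nonempty with rfl | hne
  · exact ⟨∅, by simp, hUc, fun x => ⟨Set.univ, Filter.univ_mem, Set.toFinite _⟩, by simp⟩
  obtain ⟨U, rfl⟩ := h𝒰.exists_eq_range hne
  have hex : ∀ x, ∃ n, x ∈ U n := fun x => by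
    simpa using (hUc ▸ Set.mem_univ x : x ∈ ⋃₀ Set.range U)
  -- The first covering index cannot increase nearby, so `[a x, 1]` varies lower semi-continuously.
  let N : X → ℕ := fun x => Nat.find (hex x)
  have hN : ∀ x, ∀ᶠ z in 𝓝 x, N z ≤ N x := fun x => by
    filter_upwards [(hUo _ ⟨_, rfl⟩).mem_nhds (Nat.find_spec (hex x))] with z hz
    exact Nat.find_min' _ hz
  let a : X → ℝ := fun x => 1 - 1 / (N x + 1)
  have ha0 : ∀ x, 0 ≤ a x := fun x =>
    sub_nonneg.2 (div_le_one_of_le₀ (by simp) (by positivity))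
  have ha1 : ∀ x, a x < 1 := fun x => sub_lt_self _ (by positivity)
  have hamono : ∀ x z, N z ≤ N x → a z ≤ a x := fun x z h =>
    sub_le_sub_left (one_div_le_one_div_of_le (by positivity) (by gcongr)) _
  let φ : X → Set (ULift.{u} ℝ) := fun x => ULift.down ⁻¹' Set.Icc (a x) 1
  have hφu : ∀ x, φ x = ULift.up '' Set.Icc (a x) 1 := fun x =>
    (Equiv.ulift.symm.image_eq_preimage_symm _).symm
  have hle : topologicalWeight (ULift.{u} ℝ) ≤ τ := by
    refine topologicalWeight_le_of_dense
      (s := Set.range fun q : ULift.{u} ℚ => ULift.up (q.down : ℝ)) ?_ hτ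
      (Cardinal.mk_range_le.trans ((Cardinal.mk_le_aleph0 (α := ULift.{u} ℚ)).trans hτ))
    have h1 : DenseRange fun q : ULift.{u} ℚ => (q.down : ℝ) :=
      Rat.denseRange_cast.comp (ULift.down_surjective.denseRange) Rat.continuous_coe_real
    exact (ULift.up_surjective.denseRange).comp h1 continuous_uliftUp
  obtain ⟨f, hf, hfφ, hf1⟩ := hX (ULift.{u} ℝ) hle φ (fun _ => 1) (fun _ => 0)
    (fun x => by
      have hK : IsCompact (φ x) := hφu x ▸ isCompact_Icc.image continuous_uliftUp
      exact Or.inl ⟨⟨⟨1⟩, (ha1 x).le, le_rfl⟩, hK.isClosed, hK⟩)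
    (by
      refine lowerHemicontinuous_iff_isOpen_inter_nonempty.2 fun V hV => isOpen_iff_mem_nhds.2 ?_
      rintro x ⟨y, hy, hyV⟩
      filter_upwards [hN x] with z hz
      exact ⟨y, ⟨(hamono x z hz).trans hy.1, hy.2⟩, hyV⟩)
    (fun x y hy z hz s t hs ht hst => convex_Icc (a x) 1 hy hz hs ht hst)
    lowerSemicontinuous_const (fun _ => one_pos) continuous_const
    (fun x => by
      have hax : ULift.up (a x) ∈ φ x := ⟨le_rfl, (ha1 x).le⟩
      refine (Metric.infDist_le_dist_of_mem hax).trans_lt ?_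
      rw [dist_zero_left, ULift.norm_up, Real.norm_of_nonneg (ha0 x)]
      exact ha1 x)
  let h : X → ℝ := fun x => (f x).down
  have hh : Continuous h := continuous_uliftDown.comp hf
  have hh1 : ∀ x, h x < 1 := fun x => by
    have := hf1 x
    rw [dist_zero_right, ← ULift.norm_down] at this
    exact (le_abs_self _).trans_lt this
  -- The numerator 2 makes `h x ≥ 1 - 1/(N x + 1)` a strict bound at `n = N x`; since `h x < 1`,
  -- only small `n` survive near `x`.
  let W : ℕ → Set X := fun n => U n ∩ {x | 1 - 2 / (n + 1) < h x}
  have hWl : LocallyFinite W := fun x => by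
    obtain ⟨m, hm⟩ := exists_nat_one_div_lt (half_pos (sub_pos.2 (hh1 x)))
    have hm' : h x < 1 - 2 / (m + 1) := by
      have : (2 : ℝ) / (m + 1) = 2 * (1 / (m + 1)) := by ring
      linarith
    refine ⟨{z | h z < 1 - 2 / (m + 1)}, (isOpen_lt hh continuous_const).mem_nhds hm',
      (Set.finite_lt_nat m).subset ?_⟩
    rintro n ⟨z, ⟨-, hz1⟩, hz2⟩
    have h1 : (1 : ℝ) - 2 / (n + 1) < 1 - 2 / (m + 1) := lt_trans hz1 hz2
    by_contra! hmn
    rw [Set.mem_ofPred_eq, not_lt] at hmn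
    refine absurd h1 (not_lt.2 (sub_le_sub_left ?_ _))
    gcongr
  refine ⟨Set.range W, ?_, ?_, hWl.on_range, ?_⟩
  · rintro _ ⟨n, rfl⟩
    exact (hUo _ ⟨n, rfl⟩).inter (isOpen_lt continuous_const hh)
  · rw [Set.sUnion_range]
    refine Set.eq_univ_of_forall fun x => Set.mem_iUnion.2 ⟨N x, Nat.find_spec (hex x), ?_⟩
    have h1 : a x ≤ h x := (hfφ x).1
    have h2 : (1 : ℝ) / (N x + 1) < 2 / (N x + 1) := by
      gcongr
      norm_num
    exact (sub_lt_sub_left h2 1).trans_le h1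
  · rintro _ ⟨n, rfl⟩
    exact ⟨_, ⟨n, rfl⟩, Set.inter_subset_left⟩

end HasControlledSelections

theorem theorem4p3 (X : Type u) [TopologicalSpace X] [T1Space X] (τ : Cardinal.{u})
    (hτ : ℵ₀ ≤ τ) :
    (IsCountablyParacompact X ∧ IsCollectionwiseNormal X τ) ↔
      ∀ (E : Type u) [NormedAddCommGroup E] [NormedSpace ℝ E] [CompleteSpace E],
        topologicalWeight E ≤ τ →
        ∀ (φ : X → Set E) (η : X → ℝ) (g : X → E),
          (∀ x, φ x ∈ compactsOrUniv E) → LowerHemicontinuous φ → (∀ x, Convex ℝ (φ x)) →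
          LowerSemicontinuous η → (∀ x, 0 < η x) →
          Continuous g → IsApproxSelection g η φ →
          ∃ f : X → E, Continuous f ∧ IsSelection f φ ∧ ∀ x, dist (f x) (g x) < η x := by
  constructor
  · rintro ⟨hc, hX⟩ E _ _ _ hE φ η g hφ hl hconv hη - hg hgφ
    exact exists_selection_dist_lt hX hc hτ hE hφ hl hconv hη hg hgφ
  · intro h
    have hX : HasControlledSelections X τ := h
    exact ⟨hX.isCountablyParacompact hτ, hX.isCollectionwiseNormal hτ⟩
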